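/- **Model.** $n\ge 1$ nodes with IDs $1,\dots,n$ form a complete graph and communicate in synchronous rounds; in every round each node sends $B\ge 1$ bits to every other node. An $\alpha$-ABD adversary (adaptive, mobile, Byzantine, of bounded faulty degree) selects in every round a set $F$ of edges such that every node is incident to at most $\alpha n$ edges of $F$, and replaces the $B$-bit messages sent over the edges of $F$, in both directions, by arbitrary $B$-bit messages. The set $F$ may differ from round to round; both $F$ and the replacements may depend on the current local states of all nodes, on all messages of the previous rounds, and on the messages that the nodes intend to send in the current round. The nodes are not told $F$. **Problem.** In the super-message routing problem with integer parameters $k,\lambda\ge 0$, each node $u$ is given $k$ bit strings (super-messages) $m_1(u),\dots,m_k(u)$ of at most $\lambda$ bits each. Each $m_j(u)$ has a list $\mathrm{Target}(m_j(u))$ of target nodes (of any size, possibly empty), such that each node is in the target list of at most $k$ super-messages. All nodes know the target lists of all super-messages $(u,j)$. Each node $v$ has to output, for every $(u,j)$ with $v\in\mathrm{Target}(m_j(u))$, the super-message $m_j(u)$. **Theorem.** For every constant $C$ there is a constant $K$, depending only on $C$, such that the following holds. Let $n,B\ge 1$ and $k,\lambda\ge 0$ be integers and let $0\le\alpha\le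 1/(8\cdot 10^4)$ be such that $k\le C\cdot\min(1/\alpha,\,n/\log n)$ (meaning $k\alpha\le C$ and $k\log n\le Cn$). Then there is a deterministic protocol that solves the super-message routing problem with parameters $k$ and $\lambda$ (for all target lists and all super-messages) with bandwidth $B$, against every $\alpha$-ABD adversary, within $$K\cdot\left\lceil \frac{k\lambda}{Bn}\right\rceil$$ rounds. In particular, for all constants $C,D$ there is a constant $R$, depending only on $C$ and $D$, such that, if moreover $k\lambda\le D\,nB$ (as is the case when $\lambda=\Theta(nB/k)$), then $R$ rounds suffice. -/

import Mathlib

namespace SMRouting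

/-- The content of one edge (in one direction) in one round: exactly `B` bits. -/
abbrev Msg (B : ℕ) : Type := Fin B → Bool

/-- The messages of one round; entry `u v` travels from `u` to `v`. The entry `u u` is local
memory of `u`: it is not carried by an edge and is never corrupted. -/
abbrev Traffic (n B : ℕ) : Type := Fin n → Fin n → Msg B

/-- A deterministic synchronous protocol on the `n`-clique with bandwidth `B`. Node `v` starts in
the state `init v x`, where `x` is its own input. In each of the `rounds` rounds it sends the
`B`-bit message `send v s w` to each node `w`, where `s` is its current state, and then moves to
a new state depending on `s` and on the messages it received (indexed by their claimed senders).
Local computation is unrestricted. -/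
structure Protocol (n B : ℕ) (In Out : Type) where
  rounds : ℕ
  State : Type
  init : Fin n → In → State
  send : Fin n → State → Fin n → Msg B
  update : Fin n → State → (Fin n → Msg B) → State
  output : Fin n → State → Out

variable {n B : ℕ} {In Out : Type}

/-- Everything that happened in one past round: the states of all nodes at its beginning, the
messages the nodes intended to send, and the messages that were delivered. -/
structure RoundRecord (P : Protocol n B In Out) where
  states : Fin n → P.State
  intended : Traffic n B
  delivered : Traffic n B

/-- The knowledge of a rushing adaptive adversary in a given round: all past rounds (most recent
first), the current local states of all nodes, and the messages the nodes intend to send in the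
current round. -/
structure View (P : Protocol n B In Out) where
  past : List (RoundRecord P)
  states : Fin n → P.State
  intended : Traffic n B

/-- An `α`-ABD adversary (adaptive Byzantine adversary of bounded faulty degree): in each round it
selects, depending on its whole view, a set `F` of (undirected) edges of the clique such that every
node is incident to at most `α n` edges of `F`, and the messages delivered over these edges, in
both directions. The set of edges may differ from round to round. -/
structure ABDAdversary (P : Protocol n B In Out) (α : ℝ) where
  corrupted : View P → SimpleGraph (Fin n)
  forged : View P → Traffic n B
  degree_le : ∀ (view : View P) (v : Fin n),
    (((corrupted view).neighborSet v).ncard : ℝ) ≤ α * (n : ℝ)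

/-- The messages delivered in a round. -/
noncomputable def ABDAdversary.deliver {P : Protocol n B In Out} {α : ℝ} (A : ABDAdversary P α)
    (view : View P) : Traffic n B :=
  open Classical in
  fun u v => if (A.corrupted view).Adj u v then A.forged view u v else view.intended u v

/-- The situation at the beginning of round `i` (rounds are numbered from `0`), i.e. after `i`
rounds, when the nodes run `P` on the inputs `x` against the adversary `A`. -/
noncomputable def viewAt (P : Protocol n B In Out) {α : ℝ} (A : ABDAdversary P α)
    (x : Fin n → In) : ℕ → View P
  | 0 => ⟨[], fun v => P.init v (x v), fun u v => P.send u (P.init u (x u)) v⟩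
  | i + 1 =>
    let c := viewAt P A x i
    let d := A.deliver c
    let s : Fin n → P.State := fun v => P.update v (c.states v) (fun u => d u v)
    ⟨⟨c.states, c.intended, d⟩ :: c.past, s, fun u v => P.send u (s u) v⟩

/-- The output of node `v` after all rounds of `P`. -/
noncomputable def result (P : Protocol n B In Out) {α : ℝ} (A : ABDAdversary P α)
    (x : Fin n → In) (v : Fin n) : Out :=
  P.output v ((viewAt P A x P.rounds).states v)

/-- A super-message: a bit string of at most `lam` bits. -/
abbrev SuperMsg (lam : ℕ) : Type := {l : List Bool // l.length ≤ lam}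

/-- Target lists of the super-messages `(u, j)`, where `u` is the source and `j < k`. -/
abbrev TargetLists (n k : ℕ) : Type := Fin n → Fin k → Finset (Fin n)

/-- Every node is a target of at most `k` super-messages. -/
def TargetLists.Valid {n k : ℕ} (T : TargetLists n k) : Prop :=
  ∀ v : Fin n, (Finset.univ.filter (fun p : Fin n × Fin k => v ∈ T p.1 p.2)).card ≤ k

/-- The input of one node: the target lists of all super-messages of the network, and its own
`k` super-messages. -/
structure NodeInput (n k lam : ℕ) where
  targets : TargetLists n k
  messages : Fin k → SuperMsg lam

/-- What a node outputs: one value for each super-message `(u, j)`. Only the values for those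
super-messages that are addressed to the node matter. -/
abbrev NodeOutput (n k lam : ℕ) : Type := Fin n → Fin k → SuperMsg lam

/-- `P` solves super-message routing with parameters `k` and `lam` in the `α`-ABD setting: for all
target lists, all super-messages and all adversaries, every target of every super-message outputs
that super-message correctly. -/
def SolvesRouting {n B k lam : ℕ} (α : ℝ)
    (P : Protocol n B (NodeInput n k lam) (NodeOutput n k lam)) : Prop :=
  ∀ (T : TargetLists n k), T.Valid → ∀ (m : Fin n → Fin k → SuperMsg lam)
    (A : ABDAdversary P α) (u : Fin n) (j : Fin k), ∀ v ∈ T u j,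
      result P A (fun w => ⟨T, m w⟩) v u j = m u j

/-- Super-message routing with parameters `k` and `lam` on the `n`-clique with bandwidth `B` can be
solved deterministically within `R` rounds in the `α`-ABD setting. -/
def RoutableWithin (n B k lam : ℕ) (α : ℝ) (R : ℕ) : Prop :=
  ∃ P : Protocol n B (NodeInput n k lam) (NodeOutput n k lam), P.rounds ≤ R ∧ SolvesRouting α P

/-- `k ≤ C · min (1 / α) (n / log n)`, written without division so that it also has its intended
meaning (no restriction) where `α = 0` or `log n = 0`. -/
def LoadBound (C α : ℝ) (n k : ℕ) : Prop :=
  (k : ℝ) * α ≤ C ∧ (k : ℝ) * Real.log (n : ℝ) ≤ C * (n : ℝ)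

end SMRouting

namespace SMRouting

open Finset

/-! ### Binary codes -/

/-! Each super-message is encoded by `t` codewords of length `s` over the alphabet of `B`-bit
messages, with relative distance above 1/8 (`exists_encoding`). Its `i`-th symbols travel from the
source to the `i`-th of `s` distinct relays and from there to every target. The messages of a
source, and those addressed to a target, are split into `L` colour classes served in separate
rounds, which costs `2 * t * L` rounds.

A symbol is lost for one of four reasons: a relay shared with another message of the same colour at
the source, the same at the target, or a faulty edge on either hop. Each reason affects at most `s /
64` positions, so at most `s / 16` symbols are wrong, half the minimum distance, and decoding is
unique (`RelayScheme.nonempty_relayRouting`).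

Few collisions come from random relays: an exponential moment, kept small one position at a time,
bounds all pairs of an endpoint and a message simultaneously (`exists_sum_pow_collisions_le`,
`RelayScheme.nonempty_of_pow`). This needs `s` of order `n / k`, at least `log n` for the union
bound and at least `64 * α * n` for the faults. The two halves of `LoadBound` supply exactly this
once the constant `L` is large (`exists_relayScheme`). Targets are public and computation is free,
so all nodes fix the same scheme and no randomness remains. -/

theorem sum_prod_agree {s : ℕ} (x : Fin s → Bool) :
    ∑ y : Fin s → Bool, ∏ i, (if x i = y i then 2 else 1) = 3 ^ s := by
  have h := Finset.prod_univ_sum (fun _ : Fin s => (univ : Finset Bool))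
    (fun i b => if x i = b then 2 else 1)
  rw [Fintype.piFinset_univ] at h
  rw [← h]
  have : ∀ i, ∑ b : Bool, (if x i = b then 2 else 1) = 3 := by
    intro i
    cases x i <;> simp
  rw [Finset.prod_congr rfl fun i _ => this i, Finset.prod_const, Finset.card_univ,
    Fintype.card_fin]

/-- The volume of a Hamming ball. -/
theorem card_hammingBall_mul_le {s : ℕ} (x : Fin s → Bool) (d : ℕ) :
    #{y : Fin s → Bool | hammingDist x y ≤ d} * 2 ^ (s - d) ≤ 3 ^ s := by
  -- Weight each word by 2 to the number of agreements with `x`: the total is `3 ^ s`, and each word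
  -- of the ball weighs at least `2 ^ (s - d)`.
  rw [← sum_prod_agree x, ← smul_eq_mul]
  refine (Finset.card_nsmul_le_sum _ _ _ ?_).trans
    (Finset.sum_le_sum_of_subset (Finset.subset_univ _))
  intro y hy
  have hy : hammingDist x y ≤ d := by simpa using hy
  rw [Finset.prod_ite, Finset.prod_const, Finset.prod_const_one, mul_one]
  refine Nat.pow_le_pow_right (by norm_num) ?_
  have h := Finset.card_filter_add_card_filter_not (s := (univ : Finset (Fin s)))
    (fun i => x i = y i)
  have h' : hammingDist x y = #{i | ¬ x i = y i} := rfl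
  simp only [Finset.card_univ, Fintype.card_fin] at h
  omega

/-- The greedy construction of a code with prescribed minimum distance. -/
theorem exists_pairwise_hammingDist {s d V : ℕ}
    (hV : ∀ x : Fin s → Bool, #{y : Fin s → Bool | hammingDist x y ≤ d} ≤ V)
    (N : ℕ) (hN : N * V ≤ 2 ^ s) :
    ∃ c : Fin N → Fin s → Bool, ∀ a b, a ≠ b → d < hammingDist (c a) (c b) := by
  induction N with
  | zero => exact ⟨fun a => a.elim0, fun a => a.elim0⟩
  | succ N ih =>
    have hVpos : 0 < V := by
      refine lt_of_lt_of_le (Finset.card_pos.2 ⟨fun _ => false, ?_⟩) (hV fun _ => false)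
      simp
    obtain ⟨c, hc⟩ := ih ((Nat.mul_le_mul_right V N.le_succ).trans hN)
    obtain ⟨z, hz⟩ : ∃ z, ∀ a, d < hammingDist (c a) z := by
      by_contra! hcon
      have hsub : (univ : Finset (Fin s → Bool)) ⊆
          univ.biUnion fun a => {y : Fin s → Bool | hammingDist (c a) y ≤ d} := by
        intro z _
        simpa using hcon z
      have h1 := (Finset.card_le_card hsub).trans
        (Finset.card_biUnion_le_card_mul _ _ V fun a _ => hV (c a))
      simp only [Finset.card_univ, Fintype.card_fun, Fintype.card_fin, Fintype.card_bool] at h1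
      nlinarith
    refine ⟨Fin.snoc c z, fun a b hab => ?_⟩
    induction a using Fin.lastCases with
    | last =>
      induction b using Fin.lastCases with
      | last => exact absurd rfl hab
      | cast b => simpa [hammingDist_comm] using hz b
    | cast a =>
      induction b using Fin.lastCases with
      | last => simpa using hz a
      | cast b => simpa using hc a b fun h => hab (by rw [h])

/-- Binary codes of positive rate and relative distance more than `1 / 8`, of every length. -/
theorem exists_code {s : ℕ} (hs : 0 < s) :
    ∃ c : (Fin (s / 8 + 1) → Bool) → Fin s → Bool,
      ∀ x y, x ≠ y → s < 8 * hammingDist (c x) (c y) := by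
  rcases Nat.lt_or_ge s 8 with h8 | h8
  -- Here `s / 8 + 1 = 1`, so the repetition code suffices.
  · refine ⟨fun x _ => x 0, fun x y hxy => ?_⟩
    have h0 : x 0 ≠ y 0 := by
      intro h
      refine hxy (funext fun i => ?_)
      have : i = 0 := by ext; have := i.2; simp; omega
      rw [this, h]
    have : hammingDist (fun _ : Fin s => x 0) (fun _ => y 0) = s := by
      simp [hammingDist, h0]
    simp only [this]
    omega
  -- Greedy counting at radius `s / 8`. After taking eighth powers it rests on `2 ^ 3 * 3 ^ 8 ≤ 4 ^
  -- 8`, where `8 ≤ s` absorbs the extra 1 in the dimension.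
  · have hpow : 2 ^ (s / 8 + 1) * 3 ^ s ≤ 2 ^ s * 2 ^ (s - s / 8) := by
      have h1 : (2 ^ (s / 8 + 1 + s / 8) * 3 ^ s) ^ 8 ≤ (4 ^ s) ^ 8 := by
        calc (2 ^ (s / 8 + 1 + s / 8) * 3 ^ s) ^ 8
            = 2 ^ ((s / 8 + 1 + s / 8) * 8) * (3 ^ 8) ^ s := by
              rw [mul_pow, ← pow_mul, ← pow_mul, ← pow_mul, mul_comm s 8]
          _ ≤ 2 ^ (3 * s) * (3 ^ 8) ^ s := by
              refine Nat.mul_le_mul_right _ (Nat.pow_le_pow_right (by norm_num) ?_)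
              omega
          _ = (2 ^ 3 * 3 ^ 8) ^ s := by rw [mul_pow, ← pow_mul 2 3 s]
          _ ≤ (4 ^ 8) ^ s := Nat.pow_le_pow_left (by norm_num) s
          _ = (4 ^ s) ^ 8 := by rw [← pow_mul, ← pow_mul, mul_comm]
      have h2 : 2 ^ (s / 8 + 1 + s / 8) * 3 ^ s ≤ 4 ^ s :=
        (Nat.pow_le_pow_iff_left (by norm_num)).1 h1
      refine Nat.le_of_mul_le_mul_right (c := 2 ^ (s / 8)) ?_ (by positivity)
      calc 2 ^ (s / 8 + 1) * 3 ^ s * 2 ^ (s / 8) = 2 ^ (s / 8 + 1 + s / 8) * 3 ^ s := by ring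
        _ ≤ 4 ^ s := h2
        _ = 2 ^ s * 2 ^ s := by rw [← mul_pow]; norm_num
        _ = 2 ^ s * 2 ^ (s - s / 8) * 2 ^ (s / 8) := by
            rw [mul_assoc, ← pow_add _ (s - s / 8), Nat.sub_add_cancel (Nat.div_le_self s 8)]
    obtain ⟨c, hc⟩ := exists_pairwise_hammingDist (s := s) (d := s / 8)
      (V := 3 ^ s / 2 ^ (s - s / 8))
      (fun x => (Nat.le_div_iff_mul_le (by positivity)).2 (card_hammingBall_mul_le x _))
      (2 ^ (s / 8 + 1)) (by
        refine (Nat.mul_div_le_mul_div_assoc _ _ _).trans ?_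
        exact Nat.div_le_of_le_mul (by rw [mul_comm (2 ^ (s - s / 8))]; exact hpow))
    have e : (Fin (s / 8 + 1) → Bool) ≃ Fin (2 ^ (s / 8 + 1)) :=
      Fintype.equivFinOfCardEq (by simp)
    refine ⟨fun x => c (e x), fun x y hxy => ?_⟩
    have := hc (e x) (e y) (e.injective.ne hxy)
    simp only
    omega

/-- Padding with `none` gives words of length `lam` over three symbols, and `3 ^ lam ≤ 2 ^ (2 *
lam)`; hence the factor 2. -/
theorem exists_injective_superMsg {lam X : ℕ} {α : Type*} [Fintype α] (hX : 2 * lam ≤ X)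
    (hα : 2 ^ X ≤ Fintype.card α) : ∃ φ : SuperMsg lam → α, Function.Injective φ := by
  obtain ⟨ψ⟩ : Nonempty ((Fin lam → Option Bool) ↪ α) := by
    refine Function.Embedding.nonempty_of_card_le ?_
    calc Fintype.card (Fin lam → Option Bool) = 3 ^ lam := by simp
      _ ≤ 4 ^ lam := Nat.pow_le_pow_left (by norm_num) _
      _ = 2 ^ (2 * lam) := by rw [pow_mul]; norm_num
      _ ≤ 2 ^ X := Nat.pow_le_pow_right (by norm_num) hX
      _ ≤ _ := hα
  refine ⟨fun l => ψ fun i => l.1[(i : ℕ)]?, fun l l' h => ?_⟩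
  have h' := ψ.injective h
  refine Subtype.ext (List.ext_getElem? fun i => ?_)
  rcases Nat.lt_or_ge i lam with hi | hi
  · exact congrFun h' ⟨i, hi⟩
  · rw [List.getElem?_eq_none (l.2.trans hi), List.getElem?_eq_none (l'.2.trans hi)]

/-- An encoding of super-messages by `t` words of length `s` over the alphabet of `B`-bit
messages, such that distinct super-messages differ in more than `s / 8` symbols of some word. -/
theorem exists_encoding {s B lam t : ℕ} (hs : 0 < s) (ht : 2 * lam ≤ t * B * (s / 8 + 1)) :
    ∃ enc : SuperMsg lam → Fin t → Fin s → Msg B,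
      ∀ x y, x ≠ y → ∃ r, s < 8 * hammingDist (enc x r) (enc y r) := by
  obtain ⟨c, hc⟩ := exists_code hs
  obtain ⟨φ, hφ⟩ := exists_injective_superMsg (α := Fin t → Fin B → Fin (s / 8 + 1) → Bool) ht
    (by simp only [Fintype.card_fun, Fintype.card_fin, Fintype.card_bool, ← pow_mul]
        exact Nat.pow_le_pow_right (by norm_num) (by rw [mul_comm t B, mul_assoc, mul_comm t,
          ← mul_assoc, mul_comm B]))
  -- Each of the `B` bit positions carries its own binary codeword; symbols differ wherever one bit
  -- does, so no distance is lost.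
  refine ⟨fun x r i β => c (φ x r β) i, fun x y hxy => ?_⟩
  obtain ⟨r, hr⟩ := Function.ne_iff.1 (hφ.ne hxy)
  obtain ⟨β, hβ⟩ := Function.ne_iff.1 hr
  refine ⟨r, (hc _ _ hβ).trans_le (Nat.mul_le_mul_left 8 (Finset.card_le_card ?_))⟩
  intro i
  simp only [Finset.mem_filter, Finset.mem_univ, true_and]
  exact fun h h' => h (congrFun h' β)

/-! ### Relays -/

/-- A uniformly random function takes equal values at two given distinct points with probability `1
/ q`. -/
theorem card_agree_mul {M : Type*} [Fintype M] [DecidableEq M] {q : ℕ} {a b : M} (hab : b ≠ a) :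
    #{f : M → Fin q | f b = f a} * q = Fintype.card (M → Fin q) := by
  have h : #{f : M → Fin q | f b = f a} = Fintype.card ({j // j ≠ a} → Fin q) := by
    rw [← Finset.card_univ]
    refine Finset.card_bij' (fun f _ j => f j) (fun g _ j => if h : j ≠ a then g ⟨j, h⟩
      else g ⟨b, hab⟩) ?_ ?_ ?_ ?_
    · simp
    · simp [hab]
    · intro f hf
      have hf : f b = f a := by simpa using hf
      funext j
      by_cases hj : j = a <;> simp [hj, hf]
    · intro g _
      funext j
      simp [j.2]
  rw [h, Fintype.card_congr (Equiv.funSplitAt a (Fin q)), Fintype.card_prod, Fintype.card_fin,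
    mul_comm]

/-- One step of the method of conditional expectations. -/
theorem exists_sum_collision_le {M P : Type*} [Fintype M] [DecidableEq M] {q y : ℕ} (hq : 0 < q)
    (J : Finset P) (a : P → M) (S : P → Finset M) (ha : ∀ p ∈ J, a p ∉ S p)
    (hS : ∀ p ∈ J, y * #(S p) ≤ q) (w : P → ℕ) :
    ∃ f : M → Fin q, ∑ p ∈ J, w p * (if ∃ m ∈ S p, f m = f (a p) then y else 1) ≤
      2 * ∑ p ∈ J, w p := by
  have : Nonempty (Fin q) := ⟨⟨0, hq⟩⟩
  have key : ∀ p ∈ J, ∑ f : M → Fin q, (if ∃ m ∈ S p, f m = f (a p) then y else 1) ≤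
      2 * Fintype.card (M → Fin q) := by
    intro p hp
    -- Union bound: on average the right-hand side is `1 + y * #(S p) / q ≤ 2`.
    have hle : ∀ f : M → Fin q, (if ∃ m ∈ S p, f m = f (a p) then y else 1) ≤
        1 + y * ∑ m ∈ S p, (if f m = f (a p) then 1 else 0) := by
      intro f
      split_ifs with h
      · obtain ⟨m, hm, hf⟩ := h
        have : 1 ≤ ∑ m ∈ S p, (if f m = f (a p) then 1 else 0) := by
          refine le_trans ?_ (Finset.single_le_sum (fun _ _ => Nat.zero_le _) hm)
          simp [hf]
        nlinarith
      · omega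
    refine (Finset.sum_le_sum fun f _ => hle f).trans ?_
    rw [Finset.sum_add_distrib, ← Finset.mul_sum, Finset.sum_comm, two_mul]
    refine Nat.add_le_add (by simp) ?_
    refine Nat.le_of_mul_le_mul_right (c := q) ?_ hq
    have : ∀ m ∈ S p, (∑ f : M → Fin q, if f m = f (a p) then 1 else 0) * q =
        Fintype.card (M → Fin q) := by
      intro m hm
      rw [← card_agree_mul (q := q) (a := a p) (b := m) (fun h => ha p hp (h ▸ hm)),
        Finset.card_filter]
    rw [mul_assoc, Finset.sum_mul, Finset.sum_congr rfl this, Finset.sum_const, smul_eq_mul,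
      ← mul_assoc, mul_comm]
    exact Nat.mul_le_mul_left _ (hS p hp)
  obtain ⟨f, -, hf⟩ := Finset.exists_le_of_sum_le (s := (univ : Finset (M → Fin q)))
    (f := fun f : M → Fin q => ∑ p ∈ J, w p * (if ∃ m ∈ S p, f m = f (a p) then y else 1))
    (g := fun _ => 2 * ∑ p ∈ J, w p) Finset.univ_nonempty (by
      rw [Finset.sum_comm, Finset.sum_const, smul_eq_mul, Finset.mul_sum, Finset.mul_sum]
      refine Finset.sum_le_sum fun p hp => ?_
      rw [← Finset.mul_sum, Finset.card_univ]
      nlinarith [Nat.mul_le_mul_left (w p) (key p hp)])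
  exact ⟨f, hf⟩

/-- Random relays share few positions within each group: an exponential moment bound. -/
theorem exists_sum_pow_collisions_le {M P : Type*} [Fintype M] [DecidableEq M] {q y : ℕ}
    (hq : 0 < q) (J : Finset P) (a : P → M) (S : P → Finset M) (ha : ∀ p ∈ J, a p ∉ S p)
    (hS : ∀ p ∈ J, y * #(S p) ≤ q) (s : ℕ) :
    ∃ h : Fin s → M → Fin q,
      ∑ p ∈ J, y ^ #{i : Fin s | ∃ m ∈ S p, h i m = h i (a p)} ≤ #J * 2 ^ s := by
  induction s with
  | zero => exact ⟨fun i => i.elim0, by simp⟩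
  | succ s ih =>
    obtain ⟨h, hh⟩ := ih
    obtain ⟨f, hf⟩ := exists_sum_collision_le hq J a S ha hS
      fun p => y ^ #{i : Fin s | ∃ m ∈ S p, h i m = h i (a p)}
    refine ⟨Fin.cons f h, ?_⟩
    calc ∑ p ∈ J, y ^ #{i : Fin (s + 1) | ∃ m ∈ S p,
          (Fin.cons f h : Fin (s + 1) → M → Fin q) i m =
            Fin.cons (α := fun _ => M → Fin q) f h i (a p)}
        = ∑ p ∈ J, y ^ #{i : Fin s | ∃ m ∈ S p, h i m = h i (a p)} *
            (if ∃ m ∈ S p, f m = f (a p) then y else 1) := by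
          refine Finset.sum_congr rfl fun p _ => ?_
          rw [Fin.card_filter_univ_succ']
          simp only [Fin.cons_zero, Fin.cons_succ]
          split_ifs with h1 <;> simp [pow_add, mul_comm]
      _ ≤ _ := hf
      _ ≤ 2 * (#J * 2 ^ s) := Nat.mul_le_mul_left 2 hh
      _ = _ := by ring

theorem exists_balanced_coloring {M : Type*} [DecidableEq M] (S : Finset M) {L k : ℕ}
    (hL : 0 < L) (hS : #S ≤ L * k) :
    ∃ f : M → Fin L, ∀ g, #{m ∈ S | f m = g} ≤ k := by
  obtain ⟨e⟩ : Nonempty (S ↪ Fin L × Fin k) :=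
    Function.Embedding.nonempty_of_card_le (by simpa using hS)
  refine ⟨fun m => if h : m ∈ S then (e ⟨m, h⟩).1 else ⟨0, hL⟩, fun g => ?_⟩
  rw [← Fintype.card_coe]
  refine (Fintype.card_le_of_injective (β := Fin k)
    (fun m => (e ⟨m.1, (Finset.mem_filter.1 m.2).1⟩).2) ?_).trans (by simp)
  rintro ⟨m, hm⟩ ⟨m', hm'⟩ h
  have hm1 := Finset.mem_filter.1 hm
  have hm1' := Finset.mem_filter.1 hm'
  have h1 := hm1.2
  have h1' := hm1'.2
  simp only [hm1.1, hm1'.1, dif_pos] at h1 h1'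
  have := e.injective (Prod.ext (h1.trans h1'.symm) h)
  simpa using this

/-- `relay` assigns `s` distinct relays to every element of `M`, and `color` splits every set
`S e` into `L` groups such that, within a group, only few relays of an element are shared. -/
structure RelayScheme {M E : Type*} (n s L : ℕ) (S : E → Finset M) where
  relay : M → Fin s → Fin n
  color : E → M → Fin L
  relay_injective : ∀ m, Function.Injective (relay m)
  collisions_le : ∀ e, ∀ m ∈ S e, ∀ A : Finset (Fin s),
    (∀ i ∈ A, ∃ m' ∈ S e, m' ≠ m ∧ color e m' = color e m ∧ ∃ i', relay m' i' = relay m i) →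
      64 * #A ≤ s

/-- With a colour for each message nothing is shared within a class, and all nodes can serve as
relays. -/
theorem RelayScheme.nonempty_of_card_le {M E : Type*} [DecidableEq M] {n L : ℕ}
    {S : E → Finset M} (hL : 0 < L) (hS : ∀ e, #(S e) ≤ L) :
    Nonempty (RelayScheme n n L S) := by
  classical
  choose color hcolor using fun e => exists_balanced_coloring (S e) (k := 1) hL (by simpa using hS e)
  refine ⟨⟨fun _ i => i, color, fun _ => Function.injective_id, fun e m hm A hA => ?_⟩⟩
  rw [Finset.eq_empty_of_forall_notMem (s := A)]
  · simp
  · intro i hi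
    obtain ⟨m', hm', hne, hc, -⟩ := hA i hi
    exact hne (Finset.card_le_one.1 (hcolor e (color e m)) m' (by simp [hm', hc]) m (by simp [hm]))

/-- Position `i` draws its relay from the `i`-th of `s` disjoint blocks of `q` nodes, so only equal
positions can collide. The moment bound over at most `2 ^ s` pairs leaves `(2 ^ 128) ^ c ≤ 4 ^ s`
for the number `c` of collisions of any pair, that is `64 * c ≤ s`. -/
theorem RelayScheme.nonempty_of_pow {M E : Type*} [Fintype M] [DecidableEq M] [Fintype E]
    {n s q k L : ℕ} {S : E → Finset M} (hL : 0 < L) (hk : 0 < k) (hS : ∀ e, #(S e) ≤ L * k)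
    (hq : 2 ^ 128 * k ≤ q) (hn : s * q ≤ n) (hcard : ∑ e, #(S e) ≤ 2 ^ s) :
    Nonempty (RelayScheme n s L S) := by
  classical
  have hq0 : 0 < q := lt_of_lt_of_le (by positivity) hq
  choose color hcolor using fun e => exists_balanced_coloring (S e) (k := k) hL (hS e)
  obtain ⟨h, hh⟩ := exists_sum_pow_collisions_le (y := 2 ^ 128) hq0
    ((univ : Finset E).sigma S) (fun p => p.2)
    (fun p => {m ∈ S p.1 | m ≠ p.2 ∧ color p.1 m = color p.1 p.2}) (by simp)
    (fun p _ => by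
      refine le_trans (Nat.mul_le_mul_left _ ?_) hq
      refine (Finset.card_le_card ?_).trans (hcolor p.1 (color p.1 p.2))
      intro m
      simp only [Finset.mem_filter]
      tauto) s
  rw [Finset.card_sigma] at hh
  have hbound : ∀ (i : Fin s) (x : Fin q), (i : ℕ) * q + x < n := by
    intro i x
    have := i.2
    have := x.2
    nlinarith
  have hrelay : ∀ (i i' : Fin s) (x x' : Fin q), (i : ℕ) * q + x = i' * q + x' →
      i = i' ∧ x = x' := by
    intro i i' x x' hxx
    have h1 := congrArg (· / q) hxx
    have h2 := congrArg (· % q) hxx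
    simp only [mul_comm _ q, Nat.mul_add_div hq0, Nat.div_eq_of_lt x.2, Nat.div_eq_of_lt x'.2,
      Nat.mul_add_mod, Nat.mod_eq_of_lt x.2, Nat.mod_eq_of_lt x'.2, add_zero] at h1 h2
    exact ⟨Fin.ext h1, Fin.ext h2⟩
  refine ⟨⟨fun m i => ⟨i * q + h i m, hbound i _⟩, color, fun m i i' hi => ?_, fun e m hm A hA => ?_⟩⟩
  · exact (hrelay _ _ _ _ (Fin.mk.inj_iff.1 hi)).1
  · have h1 := (Finset.single_le_sum (fun _ _ => Nat.zero_le _)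
      (show (⟨e, m⟩ : Σ _ : E, M) ∈ (univ : Finset E).sigma S by simpa using hm)).trans
        (hh.trans (Nat.mul_le_mul_right _ hcard))
    rw [← pow_mul, ← pow_add] at h1
    have h2 : 128 * _ ≤ s + s := (Nat.pow_le_pow_iff_right (by norm_num)).1 h1
    have h3 := Finset.card_le_card (s := A) (t := {i : Fin s | ∃ m' ∈ ({m' ∈ S e | m' ≠ m ∧
        color e m' = color e m} : Finset M), h i m' = h i m}) (fun i hi => by
      obtain ⟨m', hm', hne, hc, i', hi'⟩ := hA i hi
      obtain ⟨rfl, hx⟩ := hrelay _ _ _ _ (Fin.mk.inj_iff.1 hi')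
      simp only [Finset.mem_filter, Finset.mem_univ, true_and]
      exact ⟨m', ⟨hm', hne, hc⟩, hx⟩)
    simp only at h2 h3
    omega

/-! ### Protocols with full memory -/

/-- The protocol whose nodes remember their input and all messages received so far. -/
def historyProtocol {n B : ℕ} {In Out : Type} (R : ℕ)
    (send : Fin n → In → ℕ → (ℕ → Fin n → Msg B) → Fin n → Msg B)
    (out : Fin n → In → (ℕ → Fin n → Msg B) → Out) : Protocol n B In Out where
  rounds := R
  State := In × ℕ × (ℕ → Fin n → Msg B)
  init _ x := (x, 0, fun _ _ _ => false)
  send v st w := send v st.1 st.2.1 st.2.2 w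
  update _ st d := (st.1, st.2.1 + 1, Function.update st.2.2 st.2.1 d)
  output v st := out v st.1 st.2.2

section History

variable {n B : ℕ} {In Out : Type} {R : ℕ}
  {send : Fin n → In → ℕ → (ℕ → Fin n → Msg B) → Fin n → Msg B}
  {out : Fin n → In → (ℕ → Fin n → Msg B) → Out} {α : ℝ}

/-- What the node `v` has received before round `i`. -/
noncomputable def received {P : Protocol n B In Out} (A : ABDAdversary P α) (x : Fin n → In)
    (v : Fin n) (i : ℕ) : ℕ → Fin n → Msg B :=
  fun r u => if r < i then A.deliver (viewAt P A x r) u v else fun _ => false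

theorem viewAt_intended (P : Protocol n B In Out) (A : ABDAdversary P α) (x : Fin n → In)
    (i : ℕ) (u v : Fin n) :
    (viewAt P A x i).intended u v = P.send u ((viewAt P A x i).states u) v := by
  cases i <;> rfl

theorem historyProtocol_states (A : ABDAdversary (historyProtocol R send out) α)
    (x : Fin n → In) (i : ℕ) (v : Fin n) :
    (viewAt _ A x i).states v = (x v, i, received A x v i) := by
  induction i with
  | zero =>
    refine Prod.ext rfl (Prod.ext rfl ?_)
    funext r u
    simp [historyProtocol, received, viewAt]
  | succ i ih =>
    change (((viewAt _ A x i).states v).1, ((viewAt _ A x i).states v).2.1 + 1,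
      Function.update ((viewAt _ A x i).states v).2.2 ((viewAt _ A x i).states v).2.1
        fun u => A.deliver (viewAt _ A x i) u v) = _
    rw [ih]
    refine Prod.ext rfl (Prod.ext rfl ?_)
    funext r u
    by_cases hr : r = i
    · subst hr
      simp [received]
    · have : r < i + 1 ↔ r < i := by omega
      simp [received, this, Function.update_of_ne hr]

theorem historyProtocol_result (A : ABDAdversary (historyProtocol R send out) α)
    (x : Fin n → In) (v : Fin n) :
    result _ A x v = out v (x v) (received A x v R) := by
  change out v ((viewAt _ A x R).states v).1 ((viewAt _ A x R).states v).2.2 = _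
  rw [historyProtocol_states]

theorem historyProtocol_deliver (A : ABDAdversary (historyProtocol R send out) α)
    (x : Fin n → In) (i : ℕ) (u v : Fin n) (h : ¬ (A.corrupted (viewAt _ A x i)).Adj u v) :
    A.deliver (viewAt _ A x i) u v = send u (x u) i (received A x u i) v := by
  rw [ABDAdversary.deliver, if_neg h, viewAt_intended, historyProtocol_states]
  rfl

end History

/-! ### Two-hop routing and its error analysis -/

/-- The edge sets that an `α`-ABD adversary may corrupt in one round. -/
def BoundedFaults {n : ℕ} (α : ℝ) (F : SimpleGraph (Fin n)) : Prop :=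
  ∀ v, ((F.neighborSet v).ncard : ℝ) ≤ α * n

/-- A way to route through relays, for known target lists: in the rounds indexed by `ρ` the
sources send to the relays, and in as many further rounds the relays send to the targets. -/
structure RelayRouting (n B k lam : ℕ) (α : ℝ) (ρ : Type) (T : TargetLists n k) where
  toRelay : Fin n → (Fin k → SuperMsg lam) → ρ → Fin n → Msg B
  toTarget : Fin n → (ρ → Fin n → Msg B) → ρ → Fin n → Msg B
  decode : Fin n → (ρ → Fin n → Msg B) → NodeOutput n k lam
  correct : ∀ (m : Fin n → Fin k → SuperMsg lam) (F₁ F₂ : ρ → SimpleGraph (Fin n)),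
    (∀ r, BoundedFaults α (F₁ r)) → (∀ r, BoundedFaults α (F₂ r)) →
    ∀ D₁ D₂ : ρ → Traffic n B,
      (∀ r u w, ¬ (F₁ r).Adj u w → D₁ r u w = toRelay u (m u) r w) →
      (∀ r w v, ¬ (F₂ r).Adj w v → D₂ r w v = toTarget w (fun r' u => D₁ r' u w) r v) →
      ∀ u j, ∀ v ∈ T u j, decode v (fun r w => D₂ r w v) u j = m u j

/-- The target lists are part of every input, so all nodes select the same routing. Its correctness
covers arbitrary bounded fault graphs and arbitrary deliveries over them, so the adaptivity of the
adversary gives it nothing more. -/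
theorem RoutableWithin.of_relayRouting {n B k lam : ℕ} {α : ℝ} {ρ : Type} [Fintype ρ]
    (H : ∀ T : TargetLists n k, T.Valid → Nonempty (RelayRouting n B k lam α ρ T)) :
    RoutableWithin n B k lam α (2 * Fintype.card ρ) := by
  classical
  have Q := fun T hT => (H T hT).some
  set R := Fintype.card ρ
  have e : ρ ≃ Fin R := Fintype.equivFin ρ
  refine ⟨historyProtocol (2 * R)
    (fun v x r hist w => if hT : x.targets.Valid then
      if h : r < R then (Q x.targets hT).toRelay v x.messages (e.symm ⟨r, h⟩) w
      else if h : r - R < R then (Q x.targets hT).toTarget v (fun r' u => hist (e r') u)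
        (e.symm ⟨r - R, h⟩) w
      else fun _ => false
    else fun _ => false)
    (fun v x hist => if hT : x.targets.Valid then
      (Q x.targets hT).decode v (fun r w => hist (R + e r) w)
    else fun _ _ => ⟨[], Nat.zero_le _⟩), le_rfl, ?_⟩
  intro T hT m A u j v hv
  rw [historyProtocol_result]
  simp only [hT, dif_pos]
  let x : Fin n → NodeInput n k lam := fun w => ⟨T, m w⟩
  have key := (Q T hT).correct m
    (fun r => A.corrupted (viewAt _ A x (e r))) (fun r => A.corrupted (viewAt _ A x (R + e r)))
    (fun r v => A.degree_le _ v) (fun r v => A.degree_le _ v)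
    (fun r => A.deliver (viewAt _ A x (e r))) (fun r => A.deliver (viewAt _ A x (R + e r)))
    (fun r u w h => by
      rw [historyProtocol_deliver A x _ u w h]
      simp [x, hT])
    (fun r w v h => by
      rw [historyProtocol_deliver A x _ w v h]
      have : ∀ r' : ρ, (e r' : ℕ) < R + e r := fun r' => by have := (e r').2; omega
      simp [x, hT, received, this])
    u j v hv
  rw [← key]
  congr 1
  funext r w
  have : R + (e r : ℕ) < 2 * R := by have := (e r).2; omega
  simp [received, this, x]

/-- The super-messages that have `u` as their source, or that are addressed to `v`. -/
def endpointMessages {n k : ℕ} (T : TargetLists n k) : Fin n ⊕ Fin n → Finset (Fin n × Fin k)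
  | Sum.inl u => {p | p.1 = u}
  | Sum.inr v => {p | v ∈ T p.1 p.2}

theorem card_endpointMessages_le {n k : ℕ} {T : TargetLists n k} (hT : T.Valid)
    (e : Fin n ⊕ Fin n) : #(endpointMessages T e) ≤ k := by
  cases e with
  | inr v => exact hT v
  | inl u =>
    refine (Finset.card_le_card_of_injOn (t := (univ : Finset (Fin k))) Prod.snd (by simp) ?_).trans
      (by simp)
    rintro ⟨a, b⟩ h ⟨a', b'⟩ h' hb
    simp only [endpointMessages, Finset.coe_filter, Finset.mem_univ, true_and,
      Set.mem_ofPred_eq] at h h' hb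
    rw [h, h', hb]

/-- Distinct relays use distinct edges at `v`, of which at most `α * n ≤ s / 64` are faulty. -/
theorem card_le_of_boundedFaults {n s : ℕ} {α : ℝ} {F : SimpleGraph (Fin n)}
    (hF : BoundedFaults α F) (hs : 64 * (α * n) ≤ s) {f : Fin s → Fin n}
    (hf : Function.Injective f) (v : Fin n) (A : Finset (Fin s)) (hA : ∀ i ∈ A, F.Adj v (f i)) :
    64 * #A ≤ s := by
  classical
  have h1 : #A ≤ (F.neighborSet v).ncard := by
    rw [← Finset.card_image_of_injective A hf, ← Set.ncard_coe_finset]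
    refine Set.ncard_le_ncard ?_ (Set.toFinite _)
    intro w hw
    obtain ⟨i, hi, rfl⟩ := Finset.mem_image.1 (Finset.mem_coe.1 hw)
    exact hA i hi
  have h2 : ((#A : ℕ) : ℝ) ≤ α * n := le_trans (by exact_mod_cast h1) (hF v)
  have h3 : (64 : ℝ) * (#A : ℕ) ≤ s := by linarith
  exact_mod_cast h3

theorem RelayScheme.nonempty_relayRouting {n B k lam s L t : ℕ} {α : ℝ} {T : TargetLists n k}
    (Q : RelayScheme n s L (endpointMessages T)) (hs : 64 * (α * n) ≤ s)
    (enc : SuperMsg lam → Fin t → Fin s → Msg B)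
    (henc : ∀ x y, x ≠ y → ∃ r, s < 8 * hammingDist (enc x r) (enc y r)) :
    Nonempty (RelayRouting n B k lam α (Fin t × Fin L) T) := by
  classical
  refine ⟨⟨
    -- When several messages compete for one edge in one round, an arbitrary one is sent; the others
    -- count this position as an error. The relays do the same.
    fun u x r w => if h : ∃ p : Fin k × Fin s,
        Q.color (Sum.inl u) (u, p.1) = r.2 ∧ Q.relay (u, p.1) p.2 = w then
      enc (x h.choose.1) r.1 h.choose.2 else fun _ => false,
    fun w D r v => if h : ∃ m, m ∈ endpointMessages T (Sum.inr v) ∧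
        Q.color (Sum.inr v) m = r.2 ∧ ∃ i, Q.relay m i = w then
      D (r.1, Q.color (Sum.inl h.choose.1) h.choose) h.choose.1 else fun _ => false,
    fun v D u j => if h : ∃ x, ∀ r, 16 * hammingDist (enc x r)
        (fun i => D (r, Q.color (Sum.inr v) (u, j)) (Q.relay (u, j) i)) ≤ s then
      h.choose else ⟨[], Nat.zero_le _⟩, ?_⟩⟩
  intro m F₁ F₂ hF₁ hF₂ D₁ D₂ hD₁ hD₂ u j v hv
  have hclose : ∀ r, 16 * hammingDist (enc (m u j) r)
      (fun i => D₂ (r, Q.color (Sum.inr v) (u, j)) (Q.relay (u, j) i) v) ≤ s := by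
    intro r
    let collides : Fin n ⊕ Fin n → Fin s → Prop := fun e i =>
      ∃ m' ∈ endpointMessages T e, m' ≠ (u, j) ∧ Q.color e m' = Q.color e (u, j) ∧
        ∃ i', Q.relay m' i' = Q.relay (u, j) i
    have h1 := Q.collisions_le (Sum.inl u) (u, j) (by simp [endpointMessages])
      {i | collides (Sum.inl u) i} (fun i hi => (Finset.mem_filter.1 hi).2)
    have h2 := Q.collisions_le (Sum.inr v) (u, j) (by simpa [endpointMessages] using hv)
      {i | collides (Sum.inr v) i} (fun i hi => (Finset.mem_filter.1 hi).2)
    have h3 := card_le_of_boundedFaults (hF₁ (r, Q.color (Sum.inl u) (u, j))) hs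
      (Q.relay_injective (u, j)) u
      {i | (F₁ (r, Q.color (Sum.inl u) (u, j))).Adj u (Q.relay (u, j) i)}
      (fun i hi => (Finset.mem_filter.1 hi).2)
    have h4 := card_le_of_boundedFaults (hF₂ (r, Q.color (Sum.inr v) (u, j))) hs
      (Q.relay_injective (u, j)) v
      {i | (F₂ (r, Q.color (Sum.inr v) (u, j))).Adj v (Q.relay (u, j) i)}
      (fun i hi => (Finset.mem_filter.1 hi).2)
    have hsub : ({i | enc (m u j) r i ≠
        D₂ (r, Q.color (Sum.inr v) (u, j)) (Q.relay (u, j) i) v} : Finset (Fin s)) ⊆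
        (({i | collides (Sum.inl u) i} : Finset (Fin s)) ∪
          ({i | collides (Sum.inr v) i} : Finset (Fin s))) ∪
        (({i | (F₁ (r, Q.color (Sum.inl u) (u, j))).Adj u (Q.relay (u, j) i)} : Finset (Fin s)) ∪
        ({i | (F₂ (r, Q.color (Sum.inr v) (u, j))).Adj v (Q.relay (u, j) i)} :
          Finset (Fin s))) := by
      intro i
      simp only [Finset.mem_union, Finset.mem_filter, Finset.mem_univ, true_and]
      -- Outside the four bad sets both arbitrary choices are forced to be `(u, j)`, and injectivity
      -- of its relays forces position `i`.
      contrapose!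
      rintro ⟨⟨c1, c2⟩, e1, e2⟩
      rw [hD₂ _ _ _ fun h => e2 h.symm]
      have hex : ∃ m', m' ∈ endpointMessages T (Sum.inr v) ∧
          Q.color (Sum.inr v) m' = Q.color (Sum.inr v) (u, j) ∧
            ∃ i', Q.relay m' i' = Q.relay (u, j) i :=
        ⟨(u, j), by simpa [endpointMessages] using hv, rfl, i, rfl⟩
      rw [dif_pos hex]
      have hm : hex.choose = (u, j) := by
        by_contra hne
        exact c2 ⟨_, hex.choose_spec.1, hne, hex.choose_spec.2⟩
      rw [hm]
      refine Eq.trans ?_ (hD₁ _ _ _ e1).symm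
      have hex' : ∃ p : Fin k × Fin s, Q.color (Sum.inl u) (u, p.1) =
          Q.color (Sum.inl u) (u, j) ∧ Q.relay (u, p.1) p.2 = Q.relay (u, j) i := ⟨(j, i), rfl, rfl⟩
      rw [dif_pos hex']
      have hj : hex'.choose.1 = j := by
        by_contra hne
        exact c1 ⟨(u, hex'.choose.1), by simp [endpointMessages], by simpa using hne,
          hex'.choose_spec.1, _, hex'.choose_spec.2⟩
      have hi : hex'.choose.2 = i := by
        have h := hex'.choose_spec.2
        rw [hj] at h
        exact Q.relay_injective _ h
      rw [hj, hi]
    have h5 := (Finset.card_le_card hsub).trans (Finset.card_union_le _ _)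
    have h6 := Finset.card_union_le ({i | collides (Sum.inl u) i} : Finset (Fin s))
      {i | collides (Sum.inr v) i}
    have h7 := Finset.card_union_le
      ({i | (F₁ (r, Q.color (Sum.inl u) (u, j))).Adj u (Q.relay (u, j) i)} : Finset (Fin s))
      {i | (F₂ (r, Q.color (Sum.inr v) (u, j))).Adj v (Q.relay (u, j) i)}
    rw [hammingDist]
    omega
  have hex : ∃ x, ∀ r, 16 * hammingDist (enc x r)
      (fun i => D₂ (r, Q.color (Sum.inr v) (u, j)) (Q.relay (u, j) i) v) ≤ s := ⟨_, hclose⟩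
  rw [dif_pos hex]
  by_contra hne
  obtain ⟨r, hr⟩ := henc _ _ hne
  have h1 := hex.choose_spec r
  have h2 := hclose r
  have h3 := hammingDist_triangle_right (enc hex.choose r) (enc (m u j) r)
    (fun i => D₂ (r, Q.color (Sum.inr v) (u, j)) (Q.relay (u, j) i) v)
  omega

theorem RoutableWithin.mono {n B k lam R R' : ℕ} {α : ℝ} (h : RoutableWithin n B k lam α R)
    (hR : R ≤ R') : RoutableWithin n B k lam α R' :=
  let ⟨P, hP, hP'⟩ := h
  ⟨P, hP.trans hR, hP'⟩

/-- A single node has nothing to communicate. -/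
theorem routableWithin_of_le_one {n B k lam : ℕ} {α : ℝ} (hn : n ≤ 1 ∨ k = 0) :
    RoutableWithin n B k lam α 0 := by
  refine ⟨historyProtocol 0 (fun _ _ _ _ _ _ => false) (fun _ x _ _ j => x.messages j), le_rfl, ?_⟩
  intro T _ m A u j v _
  rw [historyProtocol_result]
  rcases hn with hn | rfl
  · have : v = u := by ext; omega
    rw [this]
  · exact j.elim0

/-- Routing by relay schemes with codewords of length `s`. -/
theorem routableWithin_of_relayScheme {n B k lam s L Q : ℕ} {α : ℝ} (hn : 0 < n) (hB : 0 < B)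
    (hk : 0 < k) (hs : 64 * (α * n) ≤ s) (hns : n ≤ Q * k * s)
    (H : ∀ T : TargetLists n k, T.Valid → Nonempty (RelayScheme n s L (endpointMessages T))) :
    RoutableWithin n B k lam α
      (32 * L * Q * ⌈((k : ℝ) * (lam : ℝ)) / ((B : ℝ) * (n : ℝ))⌉₊) := by
  set X := ⌈((k : ℝ) * (lam : ℝ)) / ((B : ℝ) * (n : ℝ))⌉₊
  have hs0 : 0 < s := by
    rcases Nat.eq_zero_or_pos s with rfl | h
    · omega
    · exact h
  have hX : k * lam ≤ X * (B * n) := by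
    have h := Nat.le_ceil (((k : ℝ) * (lam : ℝ)) / ((B : ℝ) * (n : ℝ)))
    rw [div_le_iff₀ (by positivity)] at h
    change _ ≤ (X : ℝ) * _ at h
    exact_mod_cast h
  -- A word carries `B * (s / 8 + 1)` bits, of order `B * n / (Q * k)`, so `16 * Q * X` words
  -- suffice. If `X = 0` then `lam = 0`, and no word is needed.
  have ht : 2 * lam ≤ 16 * Q * X * B * (s / 8 + 1) := by
    have h1 : lam ≤ X * B * Q * s := by
      refine Nat.le_of_mul_le_mul_left (c := k) ?_ hk
      calc k * lam ≤ X * (B * n) := hX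
        _ ≤ X * (B * (Q * k * s)) := by gcongr
        _ = k * (X * B * Q * s) := by ring
    have h2 : s ≤ 8 * (s / 8 + 1) := by omega
    calc 2 * lam ≤ 2 * (X * B * Q * (8 * (s / 8 + 1))) := by gcongr; exact h1.trans (by gcongr)
      _ = _ := by ring
  obtain ⟨enc, henc⟩ := exists_encoding (B := B) (lam := lam) hs0 ht
  refine RoutableWithin.mono (RoutableWithin.of_relayRouting
    (ρ := Fin (16 * Q * X) × Fin L) fun T hT => ?_) ?_
  · obtain ⟨S⟩ := H T hT
    exact S.nonempty_relayRouting hs enc henc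
  · simp only [Fintype.card_prod, Fintype.card_fin]
    refine le_of_eq ?_
    ring

/-! ### Choice of parameters -/

theorem LoadBound.mono {C C' α : ℝ} {n k : ℕ} (h : LoadBound C α n k) (hC : C ≤ C') :
    LoadBound C' α n k :=
  ⟨h.1.trans hC, h.2.trans (mul_le_mul_of_nonneg_right hC n.cast_nonneg)⟩

theorem sum_card_endpointMessages_le {n k : ℕ} {T : TargetLists n k} (hT : T.Valid) :
    ∑ e, #(endpointMessages T e) ≤ 2 * n * k := by
  refine (Finset.sum_le_card_nsmul _ _ k fun e _ => card_endpointMessages_le hT e).trans ?_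
  simp [two_mul]

/-- As `log n ≥ 1 / 2`, the logarithm of `4 * C * n ^ 2` is at most `(8 * C + 2) * log n ≤ s / 2 ≤ s
* log 2`. -/
theorem load_le_two_pow {C : ℝ} {n k s : ℕ} (hC : 1 ≤ C) (hn : 2 ≤ n)
    (hk : (k : ℝ) ≤ 2 * C * n) (hs : (16 * C + 4) * Real.log n ≤ s) : 2 * n * k ≤ 2 ^ s := by
  have hn0 : (0 : ℝ) < n := by positivity
  have hlog : 1 / 2 ≤ Real.log n := by
    have h1 := Real.log_le_log (by norm_num) (show (2 : ℝ) ≤ n by exact_mod_cast hn)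
    linarith [Real.log_two_gt_d9]
  have h1 : (2 * n * k : ℝ) ≤ 4 * C * n ^ 2 := by nlinarith
  have h2 : Real.log (4 * C * n ^ 2) ≤ s * Real.log 2 := by
    rw [Real.log_mul (by positivity) (by positivity), Real.log_pow]
    have h3 := Real.log_le_sub_one_of_pos (show 0 < 4 * C by positivity)
    have h4 : (s : ℝ) * (1 / 2) ≤ s * Real.log 2 := by
      refine mul_le_mul_of_nonneg_left ?_ s.cast_nonneg
      linarith [Real.log_two_gt_d9]
    push_cast
    nlinarith
  rw [← Real.log_pow, Real.log_le_log_iff (by positivity) (by positivity)] at h2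
  exact_mod_cast h1.trans h2

/-- Relay schemes with codewords of length of order at least `n / k`. -/
theorem exists_relayScheme {C : ℝ} (hC : 1 ≤ C) :
    ∃ L Q : ℕ, ∀ (n k : ℕ) (α : ℝ), 2 ≤ n → 0 < k → 0 ≤ α → α ≤ 1 / (8 * 10 ^ 4) →
      LoadBound C α n k → ∃ s : ℕ, 64 * (α * n) ≤ s ∧ n ≤ Q * k * s ∧
        ∀ T : TargetLists n k, T.Valid → Nonempty (RelayScheme n s L (endpointMessages T)) := by
  obtain ⟨y, hy⟩ : ∃ y : ℕ, y = 2 ^ 128 := ⟨_, rfl⟩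
  have hy0 : 0 < y := by rw [hy]; positivity
  -- Below, `s ≥ L * n / (4 * y * k) ≥ (16 * C + 64) * (C * n / k)`, and `C * n / k` dominates both
  -- `α * n` and `log n`; the sum `16 * C + 64` serves both requirements.
  obtain ⟨L, hL⟩ := exists_nat_ge (4 * y * C * (16 * C + 64))
  have hyR : (1 : ℝ) ≤ y := by exact_mod_cast hy0
  have hyC : 1 ≤ y * C := by nlinarith
  have hL0 : 0 < L := by
    have : (0 : ℝ) < L := lt_of_lt_of_le (by positivity) hL
    exact_mod_cast this
  refine ⟨L, 4 * y, fun n k α hn hk hα hα' hload => ?_⟩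
  have hn0 : (0 : ℝ) < n := by positivity
  rcases Nat.lt_or_ge L k with hkL | hkL
  · have hlog : 1 / 2 ≤ Real.log n := by
      have h1 := Real.log_le_log (by norm_num) (show (2 : ℝ) ≤ n by exact_mod_cast hn)
      linarith [Real.log_two_gt_d9]
    have hk2 : (k : ℝ) ≤ 2 * C * n := by
      have := hload.2
      nlinarith [mul_le_mul_of_nonneg_left hlog (Nat.cast_nonneg (α := ℝ) k)]
    set k' := k / L + 1 with hk'
    have hkk' : k ≤ L * k' := by
      have := Nat.lt_mul_div_succ k hL0
      exact this.le
    have hLk' : L * k' ≤ 2 * k := by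
      have := Nat.mul_div_le k L
      rw [hk', mul_add]
      omega
    set q := y * k' with hq
    have hq0 : 0 < q := by positivity
    have hLq : L * q ≤ 2 * y * k := by
      calc L * q = y * (L * k') := by rw [hq]; ring
        _ ≤ y * (2 * k) := Nat.mul_le_mul_left y hLk'
        _ = _ := by ring
    have hLqR : (L : ℝ) * q ≤ 2 * y * k := by exact_mod_cast hLq
    have hqn : q ≤ n := by
      have h1 : (L : ℝ) * q ≤ L * n := by
        calc (L : ℝ) * q ≤ 2 * y * k := hLqR
          _ ≤ 2 * y * (2 * C * n) := by gcongr
          _ = 4 * y * C * 1 * n := by ring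
          _ ≤ 4 * y * C * (16 * C + 64) * n := by gcongr; linarith
          _ ≤ L * n := by gcongr
      have h2 := le_of_mul_le_mul_left h1 (by exact_mod_cast hL0)
      exact_mod_cast h2
    set s := n / q with hs
    have hs1 : 1 ≤ s := (Nat.one_le_div_iff hq0).2 hqn
    have hnqs : n ≤ 2 * (q * s) := by
      have h1 := Nat.lt_mul_div_succ n hq0
      have h2 : q * 1 ≤ q * s := Nat.mul_le_mul_left q hs1
      rw [← hs, mul_add] at h1
      omega
    have hLn : (L : ℝ) * n ≤ 4 * y * k * s := by
      have h1 : L * n ≤ 4 * y * k * s := by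
        calc L * n ≤ L * (2 * (q * s)) := Nat.mul_le_mul_left L hnqs
          _ = 2 * s * (L * q) := by ring
          _ ≤ 2 * s * (2 * y * k) := Nat.mul_le_mul_left _ hLq
          _ = _ := by ring
      exact_mod_cast h1
    have hfour : (0 : ℝ) < 4 * y * C := by positivity
    refine ⟨s, ?_, ?_, fun T hT => ?_⟩
    · have h1 : 4 * y * C * (64 * (α * n)) ≤ 4 * y * C * s := by
        calc 4 * y * C * (64 * (α * n)) = 4 * y * C * 64 * (α * n) := by ring
          _ ≤ 4 * y * C * (16 * C + 64) * (α * n) := by gcongr; linarith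
          _ ≤ L * (α * n) := by gcongr
          _ = α * (L * n) := by ring
          _ ≤ α * (4 * y * k * s) := by gcongr
          _ = 4 * y * s * (k * α) := by ring
          _ ≤ 4 * y * s * C := by gcongr; exact hload.1
          _ = _ := by ring
      exact le_of_mul_le_mul_left h1 hfour
    · have : (L : ℝ) * n ≥ 1 * n := by gcongr; exact_mod_cast hL0
      have h1 : (n : ℝ) ≤ 4 * y * k * s := by linarith
      exact_mod_cast h1
    · refine RelayScheme.nonempty_of_pow (q := q) (k := k') hL0 (Nat.succ_pos _)
        (fun e => (card_endpointMessages_le hT e).trans hkk') (by rw [hq, hy])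
        (Nat.div_mul_le_self n q) ?_
      refine (sum_card_endpointMessages_le hT).trans (load_le_two_pow hC hn hk2 ?_)
      have h1 : 4 * y * C * ((16 * C + 4) * Real.log n) * n ≤ 4 * y * C * s * n := by
        calc 4 * y * C * ((16 * C + 4) * Real.log n) * n
            = 4 * y * C * (16 * C + 4) * (Real.log n * n) := by ring
          _ ≤ 4 * y * C * (16 * C + 64) * (Real.log n * n) := by gcongr; norm_num
          _ ≤ L * (Real.log n * n) := by gcongr
          _ = Real.log n * (L * n) := by ring
          _ ≤ Real.log n * (4 * y * k * s) := by gcongr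
          _ = 4 * y * s * (k * Real.log n) := by ring
          _ ≤ 4 * y * s * (C * n) := by gcongr 4 * y * s * ?_; exact hload.2
          _ = _ := by ring
      exact le_of_mul_le_mul_left (le_of_mul_le_mul_right h1 hn0) hfour
  -- For `k ≤ L` every message gets its own colour and `s = n`; the absolute bound on `α` then gives
  -- `64 * (α * n) ≤ n`.
  · refine ⟨n, ?_, ?_, fun T hT => RelayScheme.nonempty_of_card_le hL0
      fun e => (card_endpointMessages_le hT e).trans hkL⟩
    · nlinarith
    · exact Nat.le_mul_of_pos_left n (by positivity)

theorem exists_routableWithin_mul_ceil (C : ℝ) :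
    ∃ K : ℕ, ∀ (n B k lam : ℕ) (α : ℝ), 0 < n → 0 < B → 0 ≤ α → α ≤ 1 / (8 * 10 ^ 4) →
      LoadBound C α n k →
      RoutableWithin n B k lam α (K * ⌈((k : ℝ) * (lam : ℝ)) / ((B : ℝ) * (n : ℝ))⌉₊) := by
  obtain ⟨L, Q, H⟩ := exists_relayScheme (le_max_right C 1)
  refine ⟨32 * L * Q, fun n B k lam α hn hB hα hα' hload => ?_⟩
  by_cases htriv : n ≤ 1 ∨ k = 0
  · exact (routableWithin_of_le_one htriv).mono (Nat.zero_le _)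
  · push Not at htriv
    have hk := Nat.pos_of_ne_zero htriv.2
    obtain ⟨s, hs, hns, hT⟩ := H n k α htriv.1 hk hα hα' (hload.mono (le_max_left C 1))
    exact routableWithin_of_relayScheme hn hB hk hs hns hT

end SMRouting

theorem mainTheorem1 (C : ℝ) :
    (∃ K : ℕ, ∀ (n B k lam : ℕ) (α : ℝ), 0 < n → 0 < B → 0 ≤ α → α ≤ 1 / (8 * 10 ^ 4) →
      SMRouting.LoadBound C α n k →
      SMRouting.RoutableWithin n B k lam α
        (K * ⌈((k : ℝ) * (lam : ℝ)) / ((B : ℝ) * (n : ℝ))⌉₊)) ∧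
    (∀ D : ℝ, ∃ R : ℕ, ∀ (n B k lam : ℕ) (α : ℝ), 0 < n → 0 < B → 0 ≤ α →
      α ≤ 1 / (8 * 10 ^ 4) → SMRouting.LoadBound C α n k →
      (k : ℝ) * (lam : ℝ) ≤ D * ((n : ℝ) * (B : ℝ)) →
      SMRouting.RoutableWithin n B k lam α R) := by
  obtain ⟨K, hK⟩ := SMRouting.exists_routableWithin_mul_ceil C
  refine ⟨⟨K, hK⟩, fun D => ⟨K * ⌈D⌉₊, fun n B k lam α hn hB hα hα' hload hD => ?_⟩⟩
  refine (hK n B k lam α hn hB hα hα' hload).mono (Nat.mul_le_mul_left K (Nat.ceil_le_ceil ?_))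
  rw [div_le_iff₀ (by positivity), mul_comm (B : ℝ)]
  exact hD
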